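/- All graphs and digraphs are finite, without loops or multiple edges/arcs. A colouring $f:V\to\mathbb Z^+$ of a digraph $D=(V,A)$ is proper if, for every colour $i$, the subdigraph induced by $f^{-1}(i)$ has no directed cycle. For an integer $k\ge 0$, the digraph $D$ is $k$-list colourable if for every assignment $L$ of a set $L(v)\subseteq\mathbb Z^+$ with $|L(v)|=k$ to each vertex $v$ there is a proper colouring $f$ of $D$ with $f(v)\in L(v)$ for all $v\in V$. The list dichromatic number $\vec\chi_\ell(D)$ is the minimum $k$ such that $D$ is $k$-list colourable, and the list dichromatic number $\vec\chi_\ell(G)$ of an undirected graph $G$ is the maximum of $\vec\chi_\ell(D)$ over all orientations $D$ of $G$ (an orientation replaces each edge by exactly one of its two possible arcs). Let $K_{m*r}$ denote the complete $r$-partite graph with $m$ vertices in each part. **Theorem.** For every real $\rho>3$ there exist constants $c_1,c_2>0$, depending only on $\rho$, such that for all integers $r\ge 2$ and $m\ge\max\{(\ln r)^{\rho},2\}$, \[c_1\, r\ln m\;\le\;\vec\chi_\ell(K_{m*r})\;\le\;c_2\, r\ln m .\] -/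

import Mathlib

namespace Digraph

variable {V : Type*}

/-- A set `S` of vertices of a digraph is acyclic if the subdigraph induced by `S` has no directed
cycle. A directed cycle of length `n + 1` is a sequence of pairwise distinct vertices
`c 0, …, c n` with an arc from `c i` to `c (i + 1)` for every `i`, where the indices are cyclic
(addition in `Fin (n + 1)` is modulo `n + 1`). -/
def IsAcyclicSet (D : Digraph V) (S : Set V) : Prop :=
  ¬ ∃ (n : ℕ) (c : Fin (n + 1) → V), Function.Injective c ∧ (∀ i, c i ∈ S) ∧
    ∀ i, D.Adj (c i) (c (i + 1))

/-- A colouring of the vertices by positive integers is proper if every colour class is acyclic. -/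
def IsProperColouring (D : Digraph V) (f : V → ℕ+) : Prop :=
  ∀ i : ℕ+, D.IsAcyclicSet (f ⁻¹' {i})

/-- `D` is `k`-list colourable if for every assignment of lists of exactly `k` positive integers to
the vertices there is a proper colouring that takes at each vertex a colour of its list. -/
def IsListColourable (D : Digraph V) (k : ℕ) : Prop :=
  ∀ L : V → Finset ℕ+, (∀ v, (L v).card = k) →
    ∃ f : V → ℕ+, (∀ v, f v ∈ L v) ∧ D.IsProperColouring f

/-- The list dichromatic number of a digraph: the minimum `k` such that it is `k`-list colourable
(for finite loopless digraphs the minimum exists, see `isLeast_listDichromaticNumber`). -/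
noncomputable def listDichromaticNumber (D : Digraph V) : ℕ :=
  sInf {k | D.IsListColourable k}

theorem isListColourable_card [Finite V] (D : Digraph V) (hD : ∀ v, ¬ D.Adj v v) :
    D.IsListColourable (Nat.card V) := by
  classical
  intro L hL
  have := Fintype.ofFinite V
  have hall : ∀ s : Finset V, s.card ≤ (s.biUnion L).card := by
    intro s
    rcases s.eq_empty_or_nonempty with rfl | ⟨v, hv⟩
    · simp
    · calc s.card ≤ Nat.card V := by
            rw [Nat.card_eq_fintype_card]; exact Finset.card_le_univ s
        _ = (L v).card := (hL v).symm
        _ ≤ (s.biUnion L).card := Finset.card_le_card (Finset.subset_biUnion_of_mem L hv)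
  obtain ⟨f, hf, hfL⟩ := (Finset.all_card_le_biUnion_card_iff_exists_injective L).1 hall
  refine ⟨f, hfL, ?_⟩
  rintro i ⟨n, c, -, hS, hA⟩
  have h0 : c 0 = c (0 + 1) := hf ((hS 0).trans (hS (0 + 1)).symm)
  have h1 := hA 0
  rw [← h0] at h1
  exact hD _ h1

theorem isLeast_listDichromaticNumber [Finite V] (D : Digraph V) (hD : ∀ v, ¬ D.Adj v v) :
    IsLeast {k | D.IsListColourable k} D.listDichromaticNumber :=
  ⟨Nat.sInf_mem ⟨_, D.isListColourable_card hD⟩, fun _ hk => Nat.sInf_le hk⟩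

end Digraph

namespace SimpleGraph

variable {V : Type*}

/-- `D` is an orientation of `G`: every arc of `D` joins adjacent vertices of `G`, and every edge of
`G` is an arc of `D` in exactly one of its two directions. -/
def IsOrientation (G : SimpleGraph V) (D : Digraph V) : Prop :=
  (∀ u v, D.Adj u v → G.Adj u v) ∧ ∀ u v, G.Adj u v → Xor (D.Adj u v) (D.Adj v u)

/-- The list dichromatic number of a graph: the maximum list dichromatic number over all its
orientations (for finite graphs the maximum exists, see `isGreatest_listDichromaticNumber`). -/
noncomputable def listDichromaticNumber (G : SimpleGraph V) : ℕ :=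
  sSup {k | ∃ D : Digraph V, G.IsOrientation D ∧ D.listDichromaticNumber = k}

theorem exists_isOrientation (G : SimpleGraph V) : ∃ D : Digraph V, G.IsOrientation D := by
  classical
  let _ : LinearOrder V := linearOrderOfSTO (WellOrderingRel (α := V))
  refine ⟨⟨fun u v => G.Adj u v ∧ u < v⟩, fun _ _ h => h.1, fun u v h => ?_⟩
  rcases lt_or_gt_of_ne h.ne with h1 | h1
  · exact Or.inl ⟨⟨h, h1⟩, fun h2 => lt_asymm h1 h2.2⟩
  · exact Or.inr ⟨⟨h.symm, h1⟩, fun h2 => lt_asymm h1 h2.2⟩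

theorem isGreatest_listDichromaticNumber [Finite V] (G : SimpleGraph V) :
    IsGreatest {k | ∃ D : Digraph V, G.IsOrientation D ∧ D.listDichromaticNumber = k}
      G.listDichromaticNumber := by
  have hb : BddAbove {k | ∃ D : Digraph V, G.IsOrientation D ∧ D.listDichromaticNumber = k} := by
    refine ⟨Nat.card V, ?_⟩
    rintro _ ⟨D, hD, rfl⟩
    exact Nat.sInf_le (D.isListColourable_card fun v h => G.irrefl (hD.1 v v h))
  obtain ⟨D, hD⟩ := G.exists_isOrientation
  exact ⟨Nat.sSup_mem ⟨_, D, hD, rfl⟩ hb, fun _ hk => le_csSup hb hk⟩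

end SimpleGraph

/-! Upper bound. If every colour is reserved for a single part, all colour classes are independent,
whatever the orientation. Reserving each colour at random for one of the r parts and taking a union
bound over all r m vertices would require lists of order r ln(r m). Two stages remove the ln r. The
colours are first split between groups of s ≈ ln r parts, leaving each vertex about s ln m colours,
enough to beat a union bound over r m vertices. Each group then splits its own colours separately,
and there the union bound covers only s m ≤ m² vertices (`exists_listColouring_of_groups`).

Lower bound. In a suitable random orientation every acyclic set lies in one part up to O(ln(r m))
vertices (`exists_isOrientation_forall_isAcyclicSet`). A proper colouring thus gives each colour a
home part, with few vertices coloured away from home. Let the lists be random k-subsets of 8k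
colours. By averaging, some part is home to at most b = ⌊12k/r⌋ colours and has O((b + 1) ln(r m))
vertices coloured away from home. Yet on the order of m/2^b of its vertices are expected to have
lists avoiding all those colours (`exists_lists_forall_disjoint`), and each of them is coloured away
from home. For k < r ln m / 72 one has 2^b ≤ m^(1/6), while (ln r)³ ≤ m keeps ln(r m) below order
m^(1/3); this is a contradiction for large m. Small m leaves only boundedly many r and is absorbed
into c₁. -/

open Finset

/-! ### Probabilistic tools in counting form -/

/-- A lower tail bound for the number of successes in independent uniform trials, in counting form:
if every trial succeeds with probability at least `p`, then fewer than `q` successes among the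
trials in `I` occur with probability at most `2 ^ q * exp (-p * #I / 2)`. -/
theorem card_filter_few_successes_le {ι Ω : Type*} [Fintype ι] [DecidableEq ι] [Fintype Ω]
    [DecidableEq Ω] (I : Finset ι) (E : Finset Ω) (p : ℝ)
    (hE : p * Fintype.card Ω ≤ #E) (q : ℕ) :
    (#{ω : ι → Ω | #{i ∈ I | ω i ∈ E} < q} : ℝ) ≤
      2 ^ q * Real.exp (-(p * #I / 2)) * (Fintype.card Ω : ℝ) ^ Fintype.card ι := by
  -- Markov's inequality is applied to 2^(-X), X being the number of successes. By independence its
  -- mean factorises, and each factor in `I` is at most 1 - p/2 ≤ exp(-p/2).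
  have hfac (i : ι) : ∑ x : Ω, (if i ∈ I ∧ x ∈ E then (1 / 2 : ℝ) else 1) ≤
      (if i ∈ I then Real.exp (-(p / 2)) else 1) * Fintype.card Ω := by
    by_cases hi : i ∈ I
    · simp only [hi, true_and, if_true]
      have h1 : ∑ x : Ω, (if x ∈ E then (1 / 2 : ℝ) else 1) = Fintype.card Ω - #E / 2 := by
        have h2 (x : Ω) : (if x ∈ E then (1 / 2 : ℝ) else 1) = 1 - if x ∈ E then 1 / 2 else 0 := by
          split_ifs <;> norm_num
        simp only [h2, Finset.sum_sub_distrib, ← Finset.sum_filter]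
        simp
        ring
      rw [h1]
      have h3 := Real.add_one_le_exp (-(p / 2))
      have h4 : (0 : ℝ) ≤ Fintype.card Ω := by positivity
      nlinarith
    · simp [hi]
  have hprod : ∑ ω : ι → Ω, ∏ i, (if i ∈ I ∧ ω i ∈ E then (1 / 2 : ℝ) else 1) ≤
      Real.exp (-(p * #I / 2)) * (Fintype.card Ω : ℝ) ^ Fintype.card ι := by
    have h1 := Finset.prod_univ_sum (fun _ : ι => (univ : Finset Ω))
      (fun i x => if i ∈ I ∧ x ∈ E then (1 / 2 : ℝ) else 1)
    rw [Fintype.piFinset_univ] at h1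
    rw [← h1]
    calc _ ≤ ∏ i : ι, (if i ∈ I then Real.exp (-(p / 2)) else 1) * (Fintype.card Ω : ℝ) :=
          Finset.prod_le_prod (fun i _ => Finset.sum_nonneg fun x _ => by split_ifs <;> norm_num)
            (fun i _ => hfac i)
      _ = _ := by
        rw [Finset.prod_mul_distrib, Finset.prod_ite_mem, Finset.univ_inter, Finset.prod_const,
          Finset.prod_const, ← Real.exp_nat_mul, Finset.card_univ]
        congr 2
        ring
  have hpt (ω : ι → Ω) : (if #{i ∈ I | ω i ∈ E} < q then (1 : ℝ) else 0) ≤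
      2 ^ q * ∏ i, (if i ∈ I ∧ ω i ∈ E then (1 / 2 : ℝ) else 1) := by
    have h1 : ∏ i, (if i ∈ I ∧ ω i ∈ E then (1 / 2 : ℝ) else 1) =
        (1 / 2) ^ #{i ∈ I | ω i ∈ E} := by
      rw [← Finset.prod_filter, Finset.prod_const]
      congr 2
      ext i
      simp
    rw [h1]
    split_ifs with h
    · calc (1 : ℝ) = 2 ^ q * (1 / 2) ^ q := by rw [← mul_pow]; norm_num
        _ ≤ _ := by
          gcongr 2 ^ q * ?_
          exact pow_le_pow_of_le_one (by norm_num) (by norm_num) h.le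
    · positivity
  calc (#{ω : ι → Ω | #{i ∈ I | ω i ∈ E} < q} : ℝ)
      = ∑ ω : ι → Ω, (if #{i ∈ I | ω i ∈ E} < q then (1 : ℝ) else 0) := by simp
    _ ≤ ∑ ω : ι → Ω, 2 ^ q * ∏ i, (if i ∈ I ∧ ω i ∈ E then (1 / 2 : ℝ) else 1) :=
        Finset.sum_le_sum fun ω _ => hpt ω
    _ ≤ _ := by
      rw [← Finset.mul_sum, mul_assoc]
      gcongr

/-- The union bound: if finitely many bad events have total relative size less than one, some
outcome avoids all of them. -/
theorem exists_forall_not_of_sum_card_lt {Ω κ : Type*} [Fintype Ω] (s : Finset κ)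
    (P : κ → Ω → Prop) [∀ j, DecidablePred (P j)] (b : ℝ)
    (hb : ∀ j ∈ s, (#{ω | P j ω} : ℝ) ≤ b * Fintype.card Ω) (hs : #s * b < 1) [Nonempty Ω] :
    ∃ ω, ∀ j ∈ s, ¬ P j ω := by
  classical
  by_contra! h
  have hcov : (univ : Finset Ω) ⊆ s.biUnion fun j => {ω | P j ω} := by
    intro ω _
    obtain ⟨j, hj, hP⟩ := h ω
    exact Finset.mem_biUnion.2 ⟨j, hj, by simpa using hP⟩
  have h1 : (Fintype.card Ω : ℝ) ≤ ∑ j ∈ s, (#{ω | P j ω} : ℝ) := by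
    exact_mod_cast (Finset.card_le_card hcov).trans Finset.card_biUnion_le
  have h2 : ∑ j ∈ s, (#{ω | P j ω} : ℝ) ≤ #s * (b * Fintype.card Ω) := by
    simpa using Finset.sum_le_sum hb
  have h3 : (0 : ℝ) < Fintype.card Ω := by exact_mod_cast Fintype.card_pos
  nlinarith

/-! ### Acyclic sets and their orderings -/

namespace Digraph

variable {V : Type*}

theorem IsAcyclicSet.mono {D : Digraph V} {S T : Set V} (hT : D.IsAcyclicSet T) (h : S ⊆ T) :
    D.IsAcyclicSet S := fun ⟨n, c, hc, hS, hA⟩ => hT ⟨n, c, hc, fun i => h (hS i), hA⟩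

/-- Otherwise, repeatedly following a chosen out-neighbour inside `S` must revisit a vertex. The
orbit over one minimal period is then a directed cycle with distinct vertices. -/
theorem IsAcyclicSet.exists_sink {D : Digraph V} {S : Finset V} (hS : D.IsAcyclicSet (S : Set V))
    (hne : S.Nonempty) : ∃ v ∈ S, ∀ u ∈ S, ¬ D.Adj v u := by
  by_contra! h
  choose! f hfS hfA using h
  obtain ⟨x, hx⟩ := hne
  have hmem (n : ℕ) : f^[n] x ∈ S := by
    induction n with
    | zero => exact hx
    | succ n ih => rw [Function.iterate_succ_apply']; exact hfS _ ih
  obtain ⟨a, b, hab, heq⟩ : ∃ a b : ℕ, a < b ∧ f^[a] x = f^[b] x := by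
    obtain ⟨a, b, hne, heq⟩ := Finite.exists_ne_map_eq_of_infinite
      (fun n : ℕ => (⟨f^[n] x, hmem n⟩ : S))
    have heq : f^[a] x = f^[b] x := congrArg Subtype.val heq
    rcases lt_or_gt_of_ne hne with h | h
    · exact ⟨a, b, h, heq⟩
    · exact ⟨b, a, h, heq.symm⟩
  set y := f^[a] x with hy
  have hper : Function.IsPeriodicPt f (b - a) y := by
    rw [Function.IsPeriodicPt, Function.IsFixedPt, hy, ← Function.iterate_add_apply,
      Nat.sub_add_cancel hab.le, ← heq]
  have hpos : 0 < Function.minimalPeriod f y := hper.minimalPeriod_pos (by omega)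
  have hyS (n : ℕ) : f^[n] y ∈ S := by
    rw [hy, ← Function.iterate_add_apply]; exact hmem _
  obtain ⟨n, hn⟩ : ∃ n, Function.minimalPeriod f y = n + 1 := ⟨_, (Nat.sub_add_cancel hpos).symm⟩
  refine hS ⟨n, fun i => f^[i] y, ?_, fun i => hyS _, fun i => ?_⟩
  · intro i j hij
    have := (Function.iterate_eq_iterate_iff_of_lt_minimalPeriod (f := f) (x := y)
      (hn.symm ▸ i.isLt) (hn.symm ▸ j.isLt)).1 hij
    exact Fin.ext this
  · have h1 : f^[((i + 1 : Fin (n + 1)) : ℕ)] y = f (f^[(i : ℕ)] y) := by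
      have hmod : f^[((i : ℕ) + ((1 : Fin (n + 1)) : ℕ)) % (n + 1)] y =
          f^[(i : ℕ) + ((1 : Fin (n + 1)) : ℕ)] y := by
        have h2 := Function.iterate_mod_minimalPeriod_eq (f := f) (x := y)
          (n := (i : ℕ) + ((1 : Fin (n + 1)) : ℕ))
        rwa [hn] at h2
      rw [← Function.iterate_succ_apply' f i y, Fin.val_add, hmod]
      -- In `Fin 1` the element 1 equals 0, so a cycle of length one needs its own case.
      rcases Nat.eq_zero_or_pos n with h0 | h0
      · subst h0
        have : i = 0 := Fin.ext (by omega)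
        subst this
        have h2 := Function.iterate_minimalPeriod (f := f) (x := y)
        rw [hn] at h2
        simpa using h2.symm
      · have : ((1 : Fin (n + 1)) : ℕ) = 1 := by
          rw [Fin.val_one']; exact Nat.mod_eq_of_lt (by omega)
        rw [this]
    have h2 := hfA _ (hyS i)
    rwa [← h1] at h2

/-- The vertices of a finite acyclic set can be ordered such that all arcs go backwards. -/
theorem IsAcyclicSet.exists_list [DecidableEq V] {D : Digraph V} (S : Finset V)
    (hS : D.IsAcyclicSet (S : Set V)) :
    ∃ l : List V, l.Nodup ∧ l.toFinset = S ∧ l.Pairwise fun u v => ¬ D.Adj u v := by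
  induction S using Finset.strongInduction with
  | H S ih =>
    rcases S.eq_empty_or_nonempty with rfl | hne
    · exact ⟨[], by simp⟩
    · obtain ⟨v, hv, hsink⟩ := hS.exists_sink hne
      obtain ⟨l, hl, hlS, hp⟩ := ih (S.erase v) (Finset.erase_ssubset hv)
        (hS.mono (by simp))
      have hmem (u : V) : u ∈ l ↔ u ≠ v ∧ u ∈ S := by
        rw [← List.mem_toFinset, hlS, Finset.mem_erase]
      refine ⟨v :: l, List.nodup_cons.2 ⟨fun h => ((hmem v).1 h).1 rfl, hl⟩, ?_,
        List.pairwise_cons.2 ⟨fun u hu => hsink u ((hmem u).1 hu).2, hp⟩⟩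
      rw [List.toFinset_cons, hlS, Finset.insert_erase hv]

/-- Encoding the ordering as a function on `Fin` lets the union bound over orientations count
orderings as maps, at most |V|^n of them. -/
theorem IsAcyclicSet.exists_ordering {D : Digraph V} (S : Finset V)
    (hS : D.IsAcyclicSet (S : Set V)) :
    ∃ w : Fin #S → V, Function.Injective w ∧ Set.range w = S ∧
      ∀ i j, i < j → ¬ D.Adj (w i) (w j) := by
  classical
  obtain ⟨l, hl, hlS, hp⟩ := hS.exists_list S
  have hlen : #S = l.length := by rw [← hlS, List.toFinset_card_of_nodup hl]
  refine ⟨fun i => l.get (i.cast hlen), ?_, ?_, fun i j hij => ?_⟩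
  · exact (List.nodup_iff_injective_get.1 hl).comp (Fin.cast_injective hlen)
  · ext v
    have hv : v ∈ (S : Set V) ↔ v ∈ l := by rw [← hlS]; simp
    rw [hv]
    simp only [Set.mem_range, List.mem_iff_get]
    exact ⟨fun ⟨i, hi⟩ => ⟨_, hi⟩, fun ⟨i, hi⟩ => ⟨i.cast hlen.symm, hi⟩⟩
  · exact List.pairwise_iff_get.1 hp _ _ hij

theorem isAcyclicSet_of_forall_not_adj {D : Digraph V} {S : Set V}
    (h : ∀ u ∈ S, ∀ v ∈ S, ¬ D.Adj u v) : D.IsAcyclicSet S :=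
  fun ⟨_, c, _, hS, hA⟩ => h (c 0) (hS 0) _ (hS (0 + 1)) (hA 0)

end Digraph

/-! ### Random orientations -/

namespace SimpleGraph

variable {V : Type*}

/-- The orientation of `G` in which the edge joining `u < v` is directed upwards if and only if the
sign of `(u, v)` is `true`. -/
def signOrientation [LinearOrder V] (G : SimpleGraph V) (ω : V × V → Bool) : Digraph V where
  Adj u v := G.Adj u v ∧ if u < v then ω (u, v) = true else ω (v, u) = false

theorem isOrientation_signOrientation [LinearOrder V] (G : SimpleGraph V) (ω : V × V → Bool) :
    G.IsOrientation (G.signOrientation ω) := by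
  refine ⟨fun _ _ h => h.1, fun u v h => ?_⟩
  rcases lt_or_gt_of_ne h.ne with huv | huv
  · simp only [signOrientation, h, h.symm, huv, not_lt_of_gt huv, if_true, if_false, true_and]
    cases ω (u, v) <;> simp
  · simp only [signOrientation, h, h.symm, huv, not_lt_of_gt huv, if_true, if_false, true_and]
    cases ω (v, u) <;> simp

/-- A fixed ordering of a set spanning at least `e` edges is an acyclic ordering for a proportion of
at most `2 ^ (-e)` of all orientations. -/
theorem card_signOrientation_le [LinearOrder V] [Fintype V] (G : SimpleGraph V)
    [DecidableRel G.Adj] {n : ℕ} (w : Fin n → V) (hw : Function.Injective w) (e : ℕ)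
    [DecidablePred fun ω => ∀ i j, i < j → ¬ (G.signOrientation ω).Adj (w i) (w j)]
    (he : 2 * e ≤ #{p : Fin n × Fin n | G.Adj (w p.1) (w p.2)}) :
    #{ω : V × V → Bool | ∀ i j, i < j → ¬ (G.signOrientation ω).Adj (w i) (w j)} * 2 ^ e ≤
      Fintype.card (V × V → Bool) := by
  classical
  set T : Finset (Fin n × Fin n) := {p | w p.1 < w p.2 ∧ G.Adj (w p.1) (w p.2)} with hT
  have hTe : e ≤ #T := by
    have h1 : (univ.filter fun p : Fin n × Fin n => G.Adj (w p.1) (w p.2)) ⊆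
        T ∪ T.image Prod.swap := by
      rintro ⟨i, j⟩ h
      simp only [mem_filter, mem_univ, true_and] at h
      simp only [hT, mem_union, mem_image, mem_filter, mem_univ, true_and, Prod.exists]
      rcases lt_or_gt_of_ne h.ne with h' | h'
      · exact Or.inl ⟨h', h⟩
      · exact Or.inr ⟨j, i, ⟨h', h.symm⟩, rfl⟩
    have h2 := (card_le_card h1).trans (card_union_le _ _)
    have h3 : #(T.image Prod.swap) ≤ #T := card_image_le
    omega
  set T' : Finset (V × V) := T.image fun p => (w p.1, w p.2) with hT'
  have hcard : #T' = #T := by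
    refine card_image_of_injective _ ?_
    rintro ⟨i, j⟩ ⟨i', j'⟩ h
    simp only [Prod.mk.injEq] at h
    rw [hw h.1, hw h.2]
  -- The sign forced on an edge of `T'`: the upward arc from `w i` to `w j` is allowed only if `w i`
  -- comes later in the ordering. At least `e` signs being forced gives the factor 2^(-e).
  let b (p : V × V) : Bool := decide (∃ i j : Fin n, j < i ∧ p = (w i, w j))
  have hsub : (univ.filter fun ω : V × V → Bool =>
      ∀ i j, i < j → ¬ (G.signOrientation ω).Adj (w i) (w j)) ⊆
      Fintype.piFinset fun p => if p ∈ T' then {b p} else univ := by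
    intro ω hω
    simp only [mem_filter, mem_univ, true_and] at hω
    rw [Fintype.mem_piFinset]
    intro p
    split_ifs with hp
    · rw [mem_singleton]
      obtain ⟨⟨i, j⟩, hij, rfl⟩ := mem_image.1 hp
      simp only [hT, mem_filter, mem_univ, true_and] at hij
      obtain ⟨hlt, hadj⟩ := hij
      have hne : i ≠ j := fun h => by simp [h] at hlt
      rcases lt_or_gt_of_ne hne with h | h
      · have h1 := hω i j h
        simp only [signOrientation, hadj, hlt, if_true, true_and] at h1
        have h2 : b (w i, w j) = false := by
          simp only [b, decide_eq_false_iff_not, Prod.mk.injEq, not_exists, not_and]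
          intro i' j' hlt' h3 h4
          rw [← hw h3, ← hw h4] at hlt'
          exact lt_asymm h hlt'
        simpa [h2] using h1
      · have h1 := hω j i h
        simp only [signOrientation, hadj.symm, not_lt_of_gt hlt, if_false, true_and] at h1
        have h2 : b (w i, w j) = true := by
          simp only [b, decide_eq_true_eq]
          exact ⟨i, j, h, rfl⟩
        simpa [h2] using h1
    · exact mem_univ _
  have hpi : #(Fintype.piFinset fun p : V × V => if p ∈ T' then {b p} else univ) * 2 ^ #T' =
      Fintype.card (V × V → Bool) := by
    rw [Fintype.card_piFinset]
    have h1 (p : V × V) : #(if p ∈ T' then {b p} else (univ : Finset Bool)) =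
        if p ∈ T'ᶜ then 2 else 1 := by
      by_cases hp : p ∈ T' <;> simp [hp]
    simp only [h1]
    rw [Finset.prod_ite_mem, Finset.univ_inter, Finset.prod_const, ← pow_add, Fintype.card_fun,
      Fintype.card_bool, add_comm, card_add_card_compl]
  calc _ ≤ #(Fintype.piFinset fun p : V × V => if p ∈ T' then {b p} else univ) * 2 ^ #T' :=
        Nat.mul_le_mul (card_le_card hsub) (Nat.pow_le_pow_right (by norm_num) (hcard ▸ hTe))
    _ = _ := hpi

/-- Some orientation has no acyclic set of `n` vertices spanning many edges. -/
theorem exists_isOrientation_forall_not_isAcyclicSet [Fintype V] (G : SimpleGraph V)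
    [DecidableRel G.Adj] (n e : ℕ) (hne : Fintype.card V ^ n < 2 ^ e) :
    ∃ D : Digraph V, G.IsOrientation D ∧ ∀ S : Finset V, #S = n →
      2 * e ≤ #{p ∈ S ×ˢ S | G.Adj p.1 p.2} → ¬ D.IsAcyclicSet (S : Set V) := by
  classical
  let _ : LinearOrder V := linearOrderOfSTO (WellOrderingRel (α := V))
  set W : Finset (Fin n → V) := {w | Function.Injective w ∧
    2 * e ≤ #{p : Fin n × Fin n | G.Adj (w p.1) (w p.2)}} with hW
  obtain ⟨ω, hω⟩ := exists_forall_not_of_sum_card_lt W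
    (fun w (ω : V × V → Bool) => ∀ i j, i < j → ¬ (G.signOrientation ω).Adj (w i) (w j))
    (1 / 2 ^ e) (by
      intro w hw
      simp only [hW, mem_filter, mem_univ, true_and] at hw
      have h1 := G.card_signOrientation_le w hw.1 e hw.2
      rw [div_mul_eq_mul_div, le_div_iff₀ (by positivity), one_mul]
      exact_mod_cast h1)
    (by
      rw [mul_one_div, div_lt_one (by positivity)]
      have h1 : #W ≤ Fintype.card V ^ n := by
        simpa using card_le_univ W
      exact_mod_cast h1.trans_lt hne)
  refine ⟨G.signOrientation ω, G.isOrientation_signOrientation ω, ?_⟩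
  rintro S rfl hSe hac
  obtain ⟨w, hw, hr, hp⟩ := hac.exists_ordering S
  refine hω w ?_ hp
  simp only [hW, mem_filter, mem_univ, true_and]
  refine ⟨hw, hSe.trans ?_⟩
  refine card_le_card_of_surjOn (fun p => (w p.1, w p.2)) ?_
  rintro ⟨u, v⟩ h
  simp only [coe_filter, mem_product, Set.mem_ofPred_eq] at h
  obtain ⟨⟨hu, hv⟩, hadj⟩ := h
  have hu' : u ∈ Set.range w := hr ▸ hu
  have hv' : v ∈ Set.range w := hr ▸ hv
  obtain ⟨i, rfl⟩ := hu'
  obtain ⟨j, rfl⟩ := hv'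
  exact ⟨(i, j), by simpa using hadj, rfl⟩

/-- If no part of a complete equipartite graph contains more than half of `S`, then `S` spans at
least `#S ^ 2 / 4` edges. -/
theorem sq_card_le_two_mul_card_adj {r m : ℕ} (S : Finset (Fin r × Fin m))
    (hS : ∀ i, 2 * #{v ∈ S | v.1 = i} ≤ #S) :
    #S ^ 2 ≤ 2 * #{p ∈ S ×ˢ S | (completeEquipartiteGraph r m).Adj p.1 p.2} := by
  have h1 : #{p ∈ S ×ˢ S | (completeEquipartiteGraph r m).Adj p.1 p.2} =
      ∑ u ∈ S, #{v ∈ S | ¬ v.1 = u.1} := by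
    rw [card_filter, sum_product]
    refine sum_congr rfl fun u _ => ?_
    rw [card_filter]
    refine sum_congr rfl fun v _ => ?_
    simp [eq_comm]
  have h2 : ∀ u ∈ S, #S ≤ 2 * #{v ∈ S | ¬ v.1 = u.1} := by
    intro u _
    have h3 := card_filter_add_card_filter_not (s := S) (fun v => v.1 = u.1)
    have h4 := hS u.1
    omega
  rw [h1, mul_sum, sq]
  simpa using sum_le_sum h2

/-- Some orientation of a complete equipartite graph has all its acyclic sets contained in a single
part up to logarithmically many vertices. -/
theorem exists_isOrientation_forall_isAcyclicSet {r m h : ℕ} (hr : 0 < r) (hm : 0 < m)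
    (hh : r * m < 2 ^ h) :
    ∃ D, (completeEquipartiteGraph r m).IsOrientation D ∧
      ∀ S : Finset (Fin r × Fin m), D.IsAcyclicSet (S : Set (Fin r × Fin m)) →
        ∃ i, #{v ∈ S | v.1 ≠ i} < 4 * h := by
  have hpos : 0 < h := by
    rcases Nat.eq_zero_or_pos h with rfl | h0
    · have := Nat.mul_pos hr hm
      omega
    · exact h0
  obtain ⟨D, hD, hac⟩ := (completeEquipartiteGraph r m).exists_isOrientation_forall_not_isAcyclicSet
    -- A balanced set of 4h vertices spans at least (4h)²/4 = 4h² edges, and (r m)^(4h) < 2^(4h²).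
    (4 * h) (4 * h ^ 2) (by
      rw [Fintype.card_prod, Fintype.card_fin, Fintype.card_fin]
      calc _ < (2 ^ h) ^ (4 * h) := Nat.pow_lt_pow_left hh (by omega)
        _ = _ := by rw [← pow_mul]; ring_nf)
  refine ⟨D, hD, fun S hS => ?_⟩
  by_contra! hcon
  suffices hT : ∃ T ⊆ S, #T = 4 * h ∧ ∀ j, 2 * #{v ∈ T | v.1 = j} ≤ #T by
    obtain ⟨T, hTS, hTc, hTj⟩ := hT
    refine hac T hTc ?_ (hS.mono (by exact_mod_cast hTS))
    have h1 := sq_card_le_two_mul_card_adj T hTj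
    rw [hTc] at h1
    nlinarith
  have : Nonempty (Fin r) := ⟨⟨0, hr⟩⟩
  obtain ⟨i, hi⟩ := Finite.exists_max fun i : Fin r => #{v ∈ S | v.1 = i}
  -- If the largest part of `S` has 2h vertices, take 2h of them and 2h vertices outside that part.
  -- Otherwise no part can hold half of any 4h-subset.
  rcases le_or_gt (2 * h) #{v ∈ S | v.1 = i} with hbig | hsmall
  · obtain ⟨A, hA, hAc⟩ := exists_subset_card_eq hbig
    obtain ⟨B, hB, hBc⟩ := exists_subset_card_eq (n := 2 * h) ((by omega : 2 * h ≤ 4 * h).trans (hcon i))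
    have hA' : ∀ v ∈ A, v ∈ S ∧ v.1 = i := fun v hv => mem_filter.1 (hA hv)
    have hB' : ∀ v ∈ B, v ∈ S ∧ v.1 ≠ i := fun v hv => mem_filter.1 (hB hv)
    have hdis : Disjoint A B :=
      Finset.disjoint_left.2 fun v hvA hvB => (hB' v hvB).2 (hA' v hvA).2
    have hc : #(A ∪ B) = 4 * h := by rw [card_union_of_disjoint hdis]; omega
    refine ⟨A ∪ B, union_subset (fun v hv => (hA' v hv).1) fun v hv => (hB' v hv).1, hc,
      fun j => ?_⟩
    have key : #{v ∈ A ∪ B | v.1 = j} ≤ 2 * h := by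
      by_cases hj : j = i
      · rw [← hAc]
        refine card_le_card fun v hv => ?_
        obtain ⟨hv, hvj⟩ := mem_filter.1 hv
        exact (mem_union.1 hv).resolve_right fun hvB => (hB' v hvB).2 (hvj.trans hj)
      · rw [← hBc]
        refine card_le_card fun v hv => ?_
        obtain ⟨hv, hvj⟩ := mem_filter.1 hv
        exact (mem_union.1 hv).resolve_left fun hvA => hj (hvj.symm.trans (hA' v hvA).2)
    omega
  · obtain ⟨T, hTS, hTc⟩ := exists_subset_card_eq ((hcon i).trans (card_filter_le _ _))
    refine ⟨T, hTS, hTc, fun j => ?_⟩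
    have h1 : #{v ∈ T | v.1 = j} ≤ #{v ∈ S | v.1 = j} := card_le_card (filter_subset_filter _ hTS)
    have h2 := hi j
    omega

end SimpleGraph

/-! ### Upper bound: two-stage splitting of the colours -/

namespace SimpleGraph

/-- Splitting the colours at random between groups of `s` parts, and then inside each group at
random between its parts, yields a list colouring in which each colour is used in one part only. -/
theorem exists_listColouring_of_groups {C : Type*} [Fintype C] [DecidableEq C] {r m s g a k : ℕ}
    (hs : 0 < s) (hg : 0 < g) (hrs : r ≤ s * g)
    (hk : (r * m : ℝ) * (2 ^ a * Real.exp (-(k / g / 2))) < 1)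
    (ha : (s * m : ℝ) * (2 * Real.exp (-(a / s / 2))) < 1)
    (L : Fin r × Fin m → Finset C) (hL : ∀ v, #(L v) = k) :
    ∃ f : Fin r × Fin m → C, (∀ v, f v ∈ L v) ∧ ∀ u v, f u = f v → u.1 = v.1 := by
  classical
  let grp (v : Fin r × Fin m) : Fin g := ⟨v.1 / s, Nat.div_lt_of_lt_mul (v.1.2.trans_le hrs)⟩
  let pos (v : Fin r × Fin m) : Fin s := ⟨v.1 % s, Nat.mod_lt _ hs⟩
  have hinj (u v : Fin r × Fin m) (h1 : grp u = grp v) (h2 : pos u = pos v) : u.1 = v.1 := by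
    have h1 : (u.1 : ℕ) / s = v.1 / s := congrArg Fin.val h1
    have h2 : (u.1 : ℕ) % s = v.1 % s := congrArg Fin.val h2
    apply Fin.ext
    rw [← Nat.div_add_mod (u.1 : ℕ) s, ← Nat.div_add_mod (v.1 : ℕ) s, h1, h2]
  have : Nonempty (Fin g) := ⟨⟨0, hg⟩⟩
  have : Nonempty (Fin s) := ⟨⟨0, hs⟩⟩
  have hg' : (0 : ℝ) < g := by exact_mod_cast hg
  have hs' : (0 : ℝ) < s := by exact_mod_cast hs
  obtain ⟨φ, hφ⟩ := exists_forall_not_of_sum_card_lt (univ : Finset (Fin r × Fin m))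
    (fun v (φ : C → Fin g) => #{c ∈ L v | φ c ∈ ({grp v} : Finset (Fin g))} < a)
    (2 ^ a * Real.exp (-(k / g / 2))) (by
      intro v _
      have h1 := card_filter_few_successes_le (L v) ({grp v} : Finset (Fin g)) (1 / g)
        (by simp [hg'.ne']) a
      rw [hL] at h1
      refine h1.trans_eq ?_
      rw [Fintype.card_fun, Nat.cast_pow]
      congr 5
      ring)
    (by simpa using hk)
  -- Once `φ` is fixed, each group chooses its own split, so the union bound runs over one group of
  -- at most s m vertices. One success (q = 1) among at least `a` colours suffices.
  have hψ (x : Fin g) : ∃ ψ : C → Fin s, ∀ v ∈ (univ.filter fun v => grp v = x),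
      ¬ #{c ∈ {c ∈ L v | φ c ∈ ({grp v} : Finset (Fin g))} |
        ψ c ∈ ({pos v} : Finset (Fin s))} < 1 := by
    refine exists_forall_not_of_sum_card_lt _ _ (2 * Real.exp (-(a / s / 2))) ?_ ?_
    · intro v _
      have h1 := card_filter_few_successes_le {c ∈ L v | φ c ∈ ({grp v} : Finset (Fin g))}
        ({pos v} : Finset (Fin s)) (1 / s) (by simp [hs'.ne']) 1
      refine h1.trans ?_
      rw [Fintype.card_fun, Nat.cast_pow, pow_one]
      have h2 : (a : ℝ) ≤ #{c ∈ L v | φ c ∈ ({grp v} : Finset (Fin g))} := by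
        exact_mod_cast not_lt.1 (hφ v (mem_univ _))
      gcongr
      calc (a : ℝ) / s = 1 / s * a := by ring
        _ ≤ _ := by gcongr
    · refine lt_of_le_of_lt ?_ ha
      gcongr
      have h1 : #(univ.filter fun v => grp v = x) ≤ #(univ : Finset (Fin s × Fin m)) := by
        refine card_le_card_of_injOn (fun v => (pos v, v.2)) (fun _ _ => mem_univ _) ?_
        intro u hu v hv huv
        simp only [coe_filter, mem_univ, true_and, Set.mem_ofPred_eq] at hu hv
        simp only [Prod.mk.injEq] at huv
        exact Prod.ext (hinj u v (hu.trans hv.symm) huv.1) huv.2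
      rw [card_univ, Fintype.card_prod, Fintype.card_fin, Fintype.card_fin] at h1
      exact_mod_cast h1
  choose ψ hψ using hψ
  have hf (v : Fin r × Fin m) : ∃ c ∈ L v, φ c = grp v ∧ ψ (grp v) c = pos v := by
    have h1 := hψ (grp v) v (by simp)
    rw [not_lt, Nat.one_le_iff_ne_zero, ← Nat.pos_iff_ne_zero, card_pos] at h1
    obtain ⟨c, hc⟩ := h1
    simp only [mem_filter, mem_singleton] at hc
    exact ⟨c, hc.1.1, hc.1.2, hc.2⟩
  choose f hfL hfφ hfψ using hf
  refine ⟨f, hfL, fun u v huv => ?_⟩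
  have h1 : grp u = grp v := by rw [← hfφ u, ← hfφ v, huv]
  refine hinj u v h1 ?_
  rw [← hfψ u, ← hfψ v, h1, huv]

/-- Each colour class lies in one part, so it contains no arc at all. The palette is cut down to the
colours occurring in the lists to make it finite. -/
theorem isListColourable_of_groups {r m s g a k : ℕ}
    (hs : 0 < s) (hg : 0 < g) (hrs : r ≤ s * g)
    (hk : (r * m : ℝ) * (2 ^ a * Real.exp (-(k / g / 2))) < 1)
    (ha : (s * m : ℝ) * (2 * Real.exp (-(a / s / 2))) < 1)
    {D : Digraph (Fin r × Fin m)} (hD : (completeEquipartiteGraph r m).IsOrientation D) :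
    D.IsListColourable k := by
  classical
  intro L hL
  obtain ⟨f, hfL, hf⟩ := exists_listColouring_of_groups (C := {x // x ∈ univ.biUnion L})
    hs hg hrs hk ha (fun v => (L v).subtype (· ∈ univ.biUnion L)) (fun v => by
      rw [card_subtype, filter_true_of_mem, hL]
      exact fun x hx => mem_biUnion.2 ⟨v, mem_univ _, hx⟩)
  refine ⟨fun v => f v, fun v => mem_subtype.1 (hfL v), fun c => ?_⟩
  refine Digraph.isAcyclicSet_of_forall_not_adj fun u hu v hv huv => hD.1 u v huv ?_
  simp only [Set.mem_preimage, Set.mem_singleton_iff] at hu hv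
  exact hf u v (Subtype.ext (hu.trans hv.symm))

theorem listDichromaticNumber_completeEquipartiteGraph_le {r m : ℕ} (hr : 2 ≤ r) (hm : 2 ≤ m)
    (hrm : Real.log r ≤ m) :
    ((completeEquipartiteGraph r m).listDichromaticNumber : ℝ) ≤ 57 * r * Real.log m := by
  have hr' : (2 : ℝ) ≤ r := by exact_mod_cast hr
  have hm' : (2 : ℝ) ≤ m := by exact_mod_cast hm
  have hl2 := Real.log_two_gt_d9
  have hl2' := Real.log_two_lt_d9
  have hlm : Real.log 2 ≤ Real.log m := Real.log_le_log (by norm_num) hm'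
  have hlr : Real.log 2 ≤ Real.log r := Real.log_le_log (by norm_num) hr'
  set ℓ := Real.log m with hℓ
  -- The group size is s = ⌈ln r⌉: large enough that s ln m dominates ln r, small enough that s ≤ m.
  obtain ⟨s, hs0, hsm, hsr, hrs⟩ : ∃ s : ℕ, 0 < s ∧ s ≤ m ∧ s ≤ r ∧ Real.log r ≤ s := by
    refine ⟨⌈Real.log r⌉₊, Nat.ceil_pos.2 (by linarith), Nat.ceil_le.2 hrm, Nat.ceil_le.2 ?_,
      Nat.le_ceil _⟩
    linarith [Real.log_le_sub_one_of_pos (show (0 : ℝ) < r by linarith)]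
  have hs' : (1 : ℝ) ≤ s := by exact_mod_cast hs0
  have hsm' : (s : ℝ) ≤ m := by exact_mod_cast hsm
  set g := r / s + 1 with hg
  have hrsg : r ≤ s * g := (Nat.lt_mul_div_succ r hs0).le
  have hgs : (s * g : ℝ) ≤ 2 * r := by
    have h1 : s * g ≤ 2 * r := by
      rw [hg, mul_add, mul_one]
      have := Nat.mul_div_le r s
      omega
    exact_mod_cast h1
  have hg' : (0 : ℝ) < g := by rw [hg]; positivity
  have hsℓ : ℓ ≤ s * ℓ := by nlinarith
  have hsℓ' : (s : ℝ) ≤ 2 * (s * ℓ) := by nlinarith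
  -- With a ≥ 8sℓ the second stage fails at a vertex with probability at most 2/m⁴, against s m ≤ m²
  -- vertices.
  set a := ⌈8 * (s * ℓ)⌉₊ with ha
  have ha1 : 8 * (s * ℓ) ≤ a := Nat.le_ceil _
  have ha2 : (a : ℝ) < 8 * (s * ℓ) + 1 := Nat.ceil_lt_add_one (by linarith)
  -- Since s g ≤ 2r, this gives k/(2g) ≥ 14sℓ, whereas ln r + ℓ + a < (2 + 1 + 8 + 2)sℓ. Rounding up
  -- costs at most rℓ, whence the final constant 57.
  set k := ⌈56 * (r * ℓ)⌉₊ with hk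
  have hrℓ : 1 ≤ r * ℓ := by nlinarith
  have hk1 : 56 * (r * ℓ) ≤ k := Nat.le_ceil _
  have hk2 : (k : ℝ) < 56 * (r * ℓ) + 1 := Nat.ceil_lt_add_one (by linarith)
  obtain ⟨D, hD, hDeq⟩ := (completeEquipartiteGraph r m).isGreatest_listDichromaticNumber.1
  have hcol : D.IsListColourable k := by
    refine isListColourable_of_groups (s := s) (g := g) (a := a) hs0 (Nat.succ_pos _) hrsg ?_ ?_ hD
    · have h1 : (r * m : ℝ) * (2 ^ a * Real.exp (-(k / g / 2))) =
          Real.exp (Real.log r + ℓ + a * Real.log 2 - k / g / 2) := by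
        rw [sub_eq_add_neg, Real.exp_add, Real.exp_add, Real.exp_add, Real.exp_log (by linarith),
          Real.exp_log (by linarith), mul_comm (a : ℝ), Real.exp_mul, Real.exp_log (by norm_num),
          Real.rpow_natCast]
        ring
      rw [h1, Real.exp_lt_one_iff]
      have h2 : 28 * (s * ℓ) ≤ k / g := by
        rw [le_div_iff₀ hg']
        calc 28 * (s * ℓ) * g = 28 * (s * g) * ℓ := by ring
          _ ≤ 28 * (2 * r) * ℓ := by gcongr
          _ ≤ k := by linarith
      have h3 : a * Real.log 2 ≤ a := by nlinarith
      linarith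
    · have h1 : (s * m : ℝ) * (2 * Real.exp (-(a / s / 2))) ≤ m * m * (2 * Real.exp (-(4 * ℓ))) := by
        gcongr
        rw [div_div, le_div_iff₀ (by positivity)]
        linarith
      have h2 : Real.exp (-(4 * ℓ)) = 1 / (m : ℝ) ^ 4 := by
        rw [Real.exp_neg, show 4 * ℓ = ((4 : ℕ) : ℝ) * ℓ by norm_num, Real.exp_nat_mul, hℓ,
          Real.exp_log (by linarith), one_div]
      rw [h2] at h1
      refine h1.trans_lt ?_
      rw [mul_one_div, mul_div_assoc', div_lt_one (by positivity)]
      have h3 : (4 : ℝ) ≤ m * m := by nlinarith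
      nlinarith
  have h1 : D.listDichromaticNumber ≤ k := Nat.sInf_le hcol
  rw [hDeq] at h1
  have h2 : ((completeEquipartiteGraph r m).listDichromaticNumber : ℝ) ≤ k := by exact_mod_cast h1
  linarith

end SimpleGraph

/-! ### Lower bound: random lists against a random orientation -/

/-- By Pascal's rule, deleting one point at most halves the count while k stays at most half of what
remains. Hence a random k-subset of t colours avoids b given ones with probability at least 2^(-b).
-/
theorem Nat.choose_le_two_pow_mul_choose_sub {t k : ℕ} (b : ℕ) (h : 2 * k + b ≤ t) :
    t.choose k ≤ 2 ^ b * (t - b).choose k := by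
  induction b with
  | zero => simp
  | succ b ih =>
    refine (ih (by omega)).trans ?_
    rw [pow_succ, mul_assoc]
    refine Nat.mul_le_mul_left _ ?_
    obtain ⟨s, hs⟩ : ∃ s, t - b = s + 1 := ⟨t - b - 1, by omega⟩
    have hs' : t - (b + 1) = s := by omega
    rw [hs, hs']
    cases k with
    | zero => simp
    | succ j =>
      rw [Nat.choose_succ_succ']
      have := Nat.choose_le_succ_of_lt_half_left (r := j) (n := s) (by omega)
      omega

theorem Digraph.IsListColourable.mono {V : Type*} {D : Digraph V} {j k : ℕ}
    (h : D.IsListColourable j) (hjk : j ≤ k) : D.IsListColourable k := by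
  intro L hL
  choose L' hL' hc using fun v => exists_subset_card_eq (hjk.trans_eq (hL v).symm)
  obtain ⟨f, hf, hp⟩ := h L' hc
  exact ⟨f, fun v => hL' v (hf v), hp⟩

namespace SimpleGraph

theorem one_le_listDichromaticNumber {V : Type*} [Finite V] [Nonempty V] (G : SimpleGraph V) :
    1 ≤ G.listDichromaticNumber := by
  obtain ⟨D, hD, hDeq⟩ := G.isGreatest_listDichromaticNumber.1
  rw [Nat.one_le_iff_ne_zero]
  intro h0
  have h1 := (D.isLeast_listDichromaticNumber fun v h => G.irrefl (hD.1 v v h)).1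
  rw [hDeq, h0] at h1
  obtain ⟨f, hf, -⟩ := h1 (fun _ => ∅) (by simp)
  obtain ⟨v⟩ := ‹Nonempty V›
  simpa using hf v

/-- Random lists of `k` out of `t` colours: for every part and every set of `b` colours, at least
`q` vertices of the part have a list avoiding these colours. -/
theorem exists_lists_forall_disjoint {r m t k b q : ℕ} (hkt : 2 * k + b ≤ t)
    (hq : (r * (t : ℝ) ^ b) * (2 ^ q * Real.exp (-(1 / 2 ^ b * m / 2))) < 1) :
    ∃ L : Fin r × Fin m → Finset (Fin t), (∀ v, #(L v) = k) ∧ ∀ i, ∀ B : Finset (Fin t), #B = b →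
      q ≤ #{v | v.1 = i ∧ Disjoint (L v) B} := by
  classical
  let Ω := {A : Finset (Fin t) // #A = k}
  have hΩ : Fintype.card Ω = t.choose k := by
    rw [Fintype.card_finset_len, Fintype.card_fin]
  have : Nonempty Ω := by
    rw [← Fintype.card_pos_iff, hΩ]
    exact Nat.choose_pos (by omega)
  obtain ⟨L, hL⟩ := exists_forall_not_of_sum_card_lt
    ((univ : Finset (Fin r)) ×ˢ powersetCard b (univ : Finset (Fin t)))
    (fun x (L : Fin r × Fin m → Ω) => #{v ∈ (univ.filter fun v => v.1 = x.1) |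
      L v ∈ (univ.filter fun A : Ω => Disjoint A.1 x.2)} < q)
    (2 ^ q * Real.exp (-(1 / 2 ^ b * m / 2))) (by
      rintro ⟨i, B⟩ hB
      have hBc : #B = b := (mem_powersetCard.1 (mem_product.1 hB).2).2
      have hI : #(univ.filter fun v : Fin r × Fin m => v.1 = i) = m := by
        have : (univ.filter fun v : Fin r × Fin m => v.1 = i) = {i} ×ˢ univ := by
          ext v; simp [Prod.ext_iff, eq_comm]
        rw [this, card_product]
        simp
      have hE : #(univ.filter fun A : Ω => Disjoint A.1 B) = (t - b).choose k := by
        have h1 : #(powersetCard k Bᶜ) = (t - b).choose k := by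
          rw [card_powersetCard, card_compl, hBc, Fintype.card_fin]
        rw [← h1]
        refine card_bij (fun A _ => A.1) ?_ (fun _ _ _ _ => Subtype.ext) ?_
        · intro A hA
          rw [mem_powersetCard]
          exact ⟨subset_compl_iff_disjoint_right.2 (mem_filter.1 hA).2, A.2⟩
        · intro A hA
          rw [mem_powersetCard] at hA
          exact ⟨⟨A, hA.2⟩, by simpa using subset_compl_iff_disjoint_right.1 hA.1, rfl⟩
      have h1 := card_filter_few_successes_le (univ.filter fun v : Fin r × Fin m => v.1 = i)
        (univ.filter fun A : Ω => Disjoint A.1 B) (1 / 2 ^ b) (by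
          rw [hE, hΩ, div_mul_eq_mul_div, div_le_iff₀ (by positivity), one_mul, mul_comm]
          exact_mod_cast Nat.choose_le_two_pow_mul_choose_sub b hkt) q
      rw [hI] at h1
      rw [Fintype.card_fun, Nat.cast_pow]
      exact h1)
    (by
      refine lt_of_le_of_lt ?_ hq
      gcongr
      rw [card_product, card_powersetCard, card_univ, card_univ, Fintype.card_fin,
        Fintype.card_fin, Nat.cast_mul]
      gcongr
      exact_mod_cast Nat.choose_le_pow t b)
  refine ⟨fun v => (L v).1, fun v => (L v).2, fun i B hB => ?_⟩
  have h1 := hL (i, B) (by simp [mem_powersetCard, hB])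
  rw [not_lt] at h1
  refine h1.trans (card_le_card fun v hv => ?_)
  simpa using hv

/-- The number q = 8h(b + 1) + 1 of list-avoiding vertices, with b = ⌊12k/r⌋, is one more than the
number of vertices that averaging permits to be coloured away from home in some part. -/
theorem exists_isOrientation_not_isListColourable {r m k h : ℕ} (hr : 2 ≤ r) (hm : 0 < m)
    (hh : r * m < 2 ^ h)
    (hq : (r * ((8 * k : ℕ) : ℝ) ^ (12 * k / r)) * (2 ^ (8 * h * (12 * k / r + 1) + 1) *
      Real.exp (-(1 / 2 ^ (12 * k / r) * m / 2))) < 1) :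
    ∃ D, (completeEquipartiteGraph r m).IsOrientation D ∧ ¬ D.IsListColourable k := by
  classical
  have hpos : 0 < h := by
    rcases Nat.eq_zero_or_pos h with rfl | h0
    · have := Nat.mul_pos (by omega : 0 < r) hm
      omega
    · exact h0
  -- This makes 2k + b ≤ 8k, as the list lemma requires for 8k colours.
  have hb : 12 * k / r ≤ 6 * k := by
    calc 12 * k / r ≤ 12 * k / 2 := Nat.div_le_div_left hr (by norm_num)
      _ = 6 * k := by omega
  set b := 12 * k / r with hb_def
  obtain ⟨D, hD, hac⟩ := exists_isOrientation_forall_isAcyclicSet (by omega : 0 < r) hm hh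
  obtain ⟨L, hLk, hLB⟩ := exists_lists_forall_disjoint (k := k) (by omega) hq
  refine ⟨D, hD, fun hcol => ?_⟩
  let emb : Fin (8 * k) ↪ ℕ+ :=
    ⟨fun c => Nat.succPNat c, fun c d hcd => Fin.ext (Nat.succPNat_injective hcd)⟩
  obtain ⟨f, hfL, hf⟩ := hcol (fun v => (L v).map emb) (fun v => by rw [card_map, hLk])
  choose g hgL hgf using fun v => mem_map.1 (hfL v)
  have hclass (c : Fin (8 * k)) : ∃ i, #{v ∈ univ.filter fun v => g v = c | v.1 ≠ i} < 4 * h := by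
    refine hac _ ((hf (emb c)).mono fun v hv => ?_)
    have hv : g v = c := by simpa using hv
    simp [← hgf v, hv]
  -- `π c` is the home part of the colour `c`: fewer than 4h vertices of its class lie elsewhere.
  choose π hπ using hclass
  have hBsum : ∑ i, #{c | π c = i} = 8 * k := by
    have h1 := card_eq_sum_card_fiberwise (f := π) (s := univ) (t := univ) (by simp)
    rw [card_univ, Fintype.card_fin] at h1
    exact h1.symm
  have hXsum : ∑ i, #{v | v.1 = i ∧ π (g v) ≠ i} ≤ 8 * k * (4 * h) := by
    have h1 := card_eq_sum_card_fiberwise (f := Prod.fst)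
      (s := univ.filter fun v : Fin r × Fin m => π (g v) ≠ v.1) (t := univ) (by simp)
    have h2 := card_eq_sum_card_fiberwise (f := g)
      (s := univ.filter fun v : Fin r × Fin m => π (g v) ≠ v.1) (t := univ) (by simp)
    have h3 : ∑ i, #{v | v.1 = i ∧ π (g v) ≠ i} = ∑ i, #{v ∈ univ.filter
        fun v : Fin r × Fin m => π (g v) ≠ v.1 | v.1 = i} := by
      refine sum_congr rfl fun i _ => congrArg card ?_
      ext v
      simp only [mem_filter, mem_univ, true_and]
      constructor
      · rintro ⟨rfl, h⟩; exact ⟨h, rfl⟩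
      · rintro ⟨h, rfl⟩; exact ⟨rfl, h⟩
    rw [h3, ← h1, h2]
    calc _ ≤ ∑ _c : Fin (8 * k), 4 * h := by
          refine sum_le_sum fun c _ => (card_le_card fun v hv => ?_).trans (hπ c).le
          simp only [mem_filter, mem_univ, true_and] at hv ⊢
          obtain ⟨h4, rfl⟩ := hv
          exact ⟨rfl, h4.symm⟩
      _ = _ := by simp
  -- The weight 8h lets one averaging control both quantities: over all parts the total is at most
  -- 8h·8k + 8k·4h = 96hk.
  obtain ⟨i, -, hi⟩ : ∃ i ∈ (univ : Finset (Fin r)),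
      (8 * h * #{c | π c = i} + #{v | v.1 = i ∧ π (g v) ≠ i}) * r ≤ 96 * h * k := by
    refine exists_le_of_sum_le ⟨⟨0, by omega⟩, mem_univ _⟩ ?_
    rw [← sum_mul, sum_add_distrib, ← mul_sum, hBsum, sum_const, card_univ, Fintype.card_fin,
      smul_eq_mul, mul_comm]
    refine Nat.mul_le_mul_left _ ?_
    nlinarith
  have hBi : #{c | π c = i} ≤ b := by
    rw [hb_def, Nat.le_div_iff_mul_le (by omega)]
    have h1 : (8 * h) * (#{c | π c = i} * r) ≤ (8 * h) * (12 * k) := by nlinarith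
    exact Nat.le_of_mul_le_mul_left h1 (by omega)
  have hXi : #{v | v.1 = i ∧ π (g v) ≠ i} ≤ 8 * h * (b + 1) := by
    have h1 : 12 * k < r * (b + 1) := Nat.lt_mul_div_succ _ (by omega)
    have h3 : 8 * h * (12 * k) ≤ 8 * h * (r * (b + 1)) := Nat.mul_le_mul_left _ h1.le
    have h2 : #{v | v.1 = i ∧ π (g v) ≠ i} * r ≤ (8 * h * (b + 1)) * r :=
      calc _ ≤ _ := Nat.mul_le_mul_right r (Nat.le_add_left _ _)
        _ ≤ 96 * h * k := hi
        _ = 8 * h * (12 * k) := by ring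
        _ ≤ _ := h3
        _ = _ := by ring
    exact Nat.le_of_mul_le_mul_right h2 (by omega)
  -- The colours at home in part `i` are padded to exactly `b`. A vertex of the part whose list
  -- avoids `B` must then be coloured away from home.
  obtain ⟨B, hB, hBc⟩ := exists_superset_card_eq hBi (by rw [Fintype.card_fin]; omega)
  have h1 : #{v | v.1 = i ∧ Disjoint (L v) B} ≤ #{v | v.1 = i ∧ π (g v) ≠ i} := by
    refine card_le_card fun v hv => ?_
    simp only [mem_filter, mem_univ, true_and] at hv ⊢
    refine ⟨hv.1, fun h2 => ?_⟩
    exact Finset.disjoint_left.1 hv.2 (hgL v) (hB (by simpa using h2))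
  have h2 := hLB i B hBc
  omega

/-- Everything is measured in u = m^(1/6): 2^b ≤ u, ln m ≤ u/100 and ln r ≤ u². The positive terms
of the exponent are then of order at most u³, while the tail bound contributes at most -u⁵/2. -/
theorem exists_isOrientation_not_isListColourable_of_lt {r m k : ℕ} (hr : 2 ≤ r) (hm : 2 ≤ m)
    (hk : 1 ≤ k) (hkr : (k : ℝ) < 1 / 72 * r * Real.log m) (hrm : Real.log r ^ 3 ≤ m)
    (hlarge : 100 * Real.log m ≤ (m : ℝ) ^ (1 / 6 : ℝ)) :
    ∃ D, (completeEquipartiteGraph r m).IsOrientation D ∧ ¬ D.IsListColourable k := by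
  have hr' : (2 : ℝ) ≤ r := by exact_mod_cast hr
  have hm' : (2 : ℝ) ≤ m := by exact_mod_cast hm
  have hk' : (1 : ℝ) ≤ k := by exact_mod_cast hk
  have hl2 := Real.log_two_gt_d9
  have hl2' := Real.log_two_lt_d9
  have hlm : Real.log 2 ≤ Real.log m := Real.log_le_log (by norm_num) hm'
  have hlr : Real.log 2 ≤ Real.log r := Real.log_le_log (by norm_num) hr'
  have hmpos : (0 : ℝ) < m := by linarith
  have hrpos : (0 : ℝ) < r := by linarith
  have hrm0 : r * m ≠ 0 := by positivity
  have hh := Nat.lt_pow_succ_log_self (b := 2) (by norm_num) (r * m)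
  have hh2 := Nat.pow_log_le_self 2 hrm0
  refine exists_isOrientation_not_isListColourable hr (by omega) hh ?_
  have hlogm := Real.log_le_sub_one_of_pos hmpos
  -- The constant 1/72 is chosen here: 12/72 = 1/6.
  have hb : ((12 * k / r : ℕ) : ℝ) ≤ Real.log m / 6 := by
    refine Nat.cast_div_le.trans ?_
    rw [div_le_iff₀ hrpos]
    push_cast
    linarith
  set b := 12 * k / r
  set h := Nat.log 2 (r * m)
  set ℓ := Real.log m with hℓ
  set Λ := Real.log r + ℓ with hΛ
  have hΛ' : Real.log ((r * m : ℕ) : ℝ) = Λ := by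
    push_cast
    rw [Real.log_mul hrpos.ne' hmpos.ne']
  have hlogt : Real.log ((8 * k : ℕ) : ℝ) ≤ Λ := by
    rw [← hΛ']
    refine Real.log_le_log (by positivity) ?_
    push_cast
    nlinarith
  have hh3 : h * Real.log 2 ≤ Λ := by
    rw [← hΛ', ← Real.log_pow]
    refine Real.log_le_log (by positivity) ?_
    exact_mod_cast hh2
  have hh4 : ((h + 1 : ℕ) : ℝ) ≤ 3 * Λ := by
    push_cast
    have : (0 : ℝ) ≤ h := by positivity
    nlinarith
  obtain ⟨u, hu, hum⟩ : ∃ u : ℝ, u = Real.exp (ℓ / 6) ∧ u ^ 6 = m := by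
    refine ⟨_, rfl, ?_⟩
    rw [← Real.exp_nat_mul, ← Real.exp_log hmpos]
    congr 1
    push_cast
    ring
  have hupos : 0 < u := hu ▸ Real.exp_pos _
  have huℓ : 100 * ℓ ≤ u := by
    rw [Real.rpow_def_of_pos hmpos] at hlarge
    rw [hu]
    refine hlarge.trans_eq ?_
    congr 1
    ring
  have hru : Real.log r ≤ u ^ 2 := by
    refine le_of_pow_le_pow_left₀ (n := 3) (by norm_num) (by positivity) ?_
    rw [← pow_mul, hum]
    exact hrm
  have h2b : (2 : ℝ) ^ b ≤ u := by
    rw [hu, ← Real.rpow_natCast, Real.rpow_def_of_pos (by norm_num)]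
    refine Real.exp_le_exp.2 ?_
    have : (0 : ℝ) ≤ b := by positivity
    nlinarith
  have hmain : u ^ 5 / 2 ≤ 1 / 2 ^ b * m / 2 := by
    gcongr
    rw [← hum, div_mul_eq_mul_div, one_mul, le_div_iff₀ (by positivity)]
    calc u ^ 5 * 2 ^ b ≤ u ^ 5 * u := by gcongr
      _ = u ^ 6 := by ring
  have hexp : (r * ((8 * k : ℕ) : ℝ) ^ b) * (2 ^ (8 * (h + 1) * (b + 1) + 1) *
      Real.exp (-(1 / 2 ^ b * m / 2))) = Real.exp (Real.log r + b * Real.log ((8 * k : ℕ) : ℝ) +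
        ((8 * (h + 1) * (b + 1) + 1 : ℕ) : ℝ) * Real.log 2 - 1 / 2 ^ b * m / 2) := by
    rw [sub_eq_add_neg, Real.exp_add, Real.exp_add, Real.exp_add, Real.exp_log hrpos,
      ← Real.log_pow, ← Real.log_pow, Real.exp_log (by positivity), Real.exp_log (by positivity)]
    ring
  rw [hexp, Real.exp_lt_one_iff]
  have hΛ1 : 1 ≤ Λ := by linarith
  have hb0 : (0 : ℝ) ≤ b := by positivity
  have e1 : b * Real.log ((8 * k : ℕ) : ℝ) ≤ ℓ / 6 * Λ :=
    mul_le_mul hb hlogt (Real.log_nonneg (by push_cast; linarith)) (by linarith)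
  have e2 : ((8 * (h + 1) * (b + 1) + 1 : ℕ) : ℝ) * Real.log 2 ≤
      24 * Λ * (ℓ / 6 + 1) + 1 := by
    have h1 : ((8 * (h + 1) * (b + 1) + 1 : ℕ) : ℝ) ≤ 24 * Λ * (ℓ / 6 + 1) + 1 := by
      calc ((8 * (h + 1) * (b + 1) + 1 : ℕ) : ℝ) = 8 * ((h + 1 : ℕ) : ℝ) * (b + 1) + 1 := by
            push_cast; ring
        _ ≤ 8 * (3 * Λ) * (ℓ / 6 + 1) + 1 := by gcongr
        _ = _ := by ring
    refine le_trans ?_ h1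
    exact mul_le_of_le_one_right (by positivity) (by linarith)
  have e3 : Λ ≤ 2 * u ^ 2 := by nlinarith
  have e4 : Λ * ℓ ≤ u ^ 3 / 50 := by
    calc Λ * ℓ ≤ 2 * u ^ 2 * (u / 100) := by gcongr; linarith
      _ = _ := by ring
  have e5 : Λ ≤ 2 * (Λ * ℓ) := by
    calc Λ = Λ * 1 := (mul_one Λ).symm
      _ ≤ Λ * (2 * ℓ) := by gcongr; linarith
      _ = _ := by ring
  have hu2 : (2 : ℝ) ≤ u := by linarith
  have e6 : u ^ 3 * 4 ≤ u ^ 5 := by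
    have : (2 : ℝ) ^ 2 ≤ u ^ 2 := by gcongr
    norm_num at this
    calc u ^ 3 * 4 ≤ u ^ 3 * u ^ 2 := by gcongr
      _ = u ^ 5 := by ring
  have e7 : 0 < u ^ 3 := by positivity
  linarith

end SimpleGraph

/-! ### Conclusion and choice of constants -/

open SimpleGraph in
theorem theorem3p4 (ρ : ℝ) (hρ : 3 < ρ) :
    ∃ c₁ c₂ : ℝ, 0 < c₁ ∧ 0 < c₂ ∧
      ∀ r m : ℕ, 2 ≤ r → max (Real.log (r : ℝ) ^ ρ) 2 ≤ (m : ℝ) →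
        c₁ * (r : ℝ) * Real.log (m : ℝ) ≤
            ((SimpleGraph.completeEquipartiteGraph r m).listDichromaticNumber : ℝ) ∧
          ((SimpleGraph.completeEquipartiteGraph r m).listDichromaticNumber : ℝ) ≤
            c₂ * (r : ℝ) * Real.log (m : ℝ) := by
  obtain ⟨M, hM1, hM⟩ : ∃ M : ℝ, 1 ≤ M ∧ ∀ x, M ≤ x → 100 * Real.log x ≤ x ^ (1 / 6 : ℝ) := by
    have h1 := (isLittleO_log_rpow_atTop (by norm_num : (0 : ℝ) < 1 / 6)).bound
      (by norm_num : (0 : ℝ) < 1 / 100)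
    obtain ⟨M, hM⟩ := Filter.eventually_atTop.1 h1
    refine ⟨max M 1, le_max_right _ _, fun x hx => ?_⟩
    have h2 := hM x ((le_max_left _ _).trans hx)
    have hx1 : 1 ≤ x := (le_max_right _ _).trans hx
    rw [Real.norm_of_nonneg (Real.log_nonneg hx1), Real.norm_of_nonneg (by positivity)] at h2
    linarith
  -- The second entry serves m < M: there ln r ≤ m bounds r by exp M, so c₁ r ln m ≤ 1, which every
  -- nonempty graph satisfies.
  have hc : 0 < min (1 / 72) (1 / (Real.exp M * M)) :=
    lt_min (by norm_num) (by positivity)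
  refine ⟨min (1 / 72) (1 / (Real.exp M * M)), 57, hc, by norm_num, fun r m hr hrm => ?_⟩
  have hm' : (2 : ℝ) ≤ m := (le_max_right _ _).trans hrm
  have hm : 2 ≤ m := by exact_mod_cast hm'
  have hr' : (2 : ℝ) ≤ r := by exact_mod_cast hr
  have hlr : 0 ≤ Real.log r := Real.log_nonneg (by linarith)
  have hlm : 0 ≤ Real.log m := Real.log_nonneg (by linarith)
  have hrm3 : Real.log r ^ 3 ≤ m := by
    rcases le_or_gt (Real.log r) 1 with h1 | h1
    · linarith [pow_le_one₀ (n := 3) hlr h1]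
    · calc Real.log r ^ 3 = Real.log r ^ (3 : ℝ) := by norm_cast
        _ ≤ Real.log r ^ ρ := Real.rpow_le_rpow_of_exponent_le h1.le hρ.le
        _ ≤ m := (le_max_left _ _).trans hrm
  have hrm1 : Real.log r ≤ m := by
    rcases le_or_gt (Real.log r) 1 with h1 | h1
    · linarith
    · exact (le_self_pow₀ h1.le (by norm_num)).trans hrm3
  refine ⟨?_, listDichromaticNumber_completeEquipartiteGraph_le hr hm hrm1⟩
  have : Nonempty (Fin r × Fin m) := ⟨(⟨0, by omega⟩, ⟨0, by omega⟩)⟩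
  have hone := (completeEquipartiteGraph r m).one_le_listDichromaticNumber
  rcases le_or_gt M m with hMm | hMm
  -- The list size is taken to be the list dichromatic number of the graph itself, for which every
  -- orientation is list colourable.
  · by_contra! hlt
    obtain ⟨D, hD, hnot⟩ := exists_isOrientation_not_isListColourable_of_lt hr hm hone
      (hlt.trans_le (by gcongr; exact min_le_left _ _)) hrm3 (hM m hMm)
    refine hnot ((D.isLeast_listDichromaticNumber fun v h => ?_).1.mono
      ((completeEquipartiteGraph r m).isGreatest_listDichromaticNumber.2 ⟨D, hD, rfl⟩))
    exact (completeEquipartiteGraph r m).irrefl (hD.1 v v h)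
  · have hrM : (r : ℝ) ≤ Real.exp M := by
      rw [← Real.log_le_iff_le_exp (by linarith)]
      linarith
    have hlM : Real.log m ≤ M := by
      linarith [Real.log_le_sub_one_of_pos (show (0 : ℝ) < m by linarith)]
    calc min (1 / 72) (1 / (Real.exp M * M)) * r * Real.log m
        ≤ 1 / (Real.exp M * M) * Real.exp M * M := by
          gcongr
          exact min_le_right _ _
      _ = 1 := by
          rw [mul_assoc, one_div, inv_mul_cancel₀ (by positivity)]
      _ ≤ _ := by exact_mod_cast hone
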